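/- Consider two coupled nodes $i=1,2$ with dynamics $x_{k+1,i}=Ax_{k,i}+\mu\sum_{j}a_{ij}Gx_{k,j}+\omega_{k,i}$ and sensors $y_{k,i}=Cx_{k,i}+\nu_{k,i}$, where $\mu\ge 0$, $a_{ij}\in\{0,1\}$, $a_{ii}=0$, and the noises have covariances $Q_i>0$, $R_i>0$. Put $\tilde A=\sqrt{1+\mu}\,A$, $\tilde G=\sqrt{\mu+\mu^2}\,G$, $\mathcal N_i=\{j: a_{ij}=1\}$, $d_i=|\mathcal N_i|$, $d_m=\max_i d_i$, and, for $Y=(Y_1,Y_2)$, $h_i(Y)=\tilde AY_i\tilde A^T+d_i\sum_{j\in\mathcal N_i}\tilde GY_j\tilde G^T+Q_i$. Assume that $(\tilde A,d_m\tilde G,C)$ is detectable, i.e. for some $K$ the system $z_{k+1}=(I-KC)(\tilde A+d_m\tilde G w_k)z_k$, with independent standard Gaussian $w_k\in\mathbb R$, is asymptotically mean-square stable. Let $P_i=\lim_k P^d_{k,i}$ be the steady state of $P^d_{k+1,i}=\big(h_i(P^d_{k})^{-1}+C^TR_i^{-1}C\big)^{-1}$, $P^d_{0,i}=0$. For $s=(\tau_1,\tau_2)\in\mathbb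 Z_+^2$ (the times since the last packets were received) and $k\ge\max_i\tau_i$, define $Y_{l,i}=P_i$ for $0\le l\le k-\tau_i$ and $Y_{l,i}=h_i(Y_{l-1})$ for $k-\tau_i<l<k$. The one-stage cost of the action $a=(\alpha_1,\alpha_2)\in\{0,1\}^2$ in state $s$ is $c(s,a)=\sum_{i}\big(\mathrm{Tr}\,h_i(Y_{k-1})+\kappa\alpha_i\big)$ with $\kappa>0$ (it does not depend on the choice of $k$). Given $(s,a)$, the two components of the next state are independent: if $\alpha_i=1$, then $\tau_i$ becomes $1$ with probability $\lambda\in[0,1]$ and $\tau_i+1$ with probability $1-\lambda$; if $\alpha_i=0$, then $\tau_i$ becomes $\tau_i+1$. A policy $\pi$ chooses the action $a_k$ as a function of $k$, $s_0,\dots,s_k$ and $a_0,\dots,a_{k-1}$; it is feasible if it schedules exactly one sensor at each step ($N=2$, $M=1$). It is optimal if it is feasible and, for every initial state $s_0$, minimizes $J(s_0,\pi)=\limsup_{T\to\infty}\frac1T\mathbb E^{\pi}_{s_0}\big[\sum_{k=1}^Tc(s_k,a_k)\big]$ over all feasible policies. Suppose that 1. $(1-\lambda)\rho(U)^{2r}<1$,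 where $r=\lceil N/M\rceil=2$, $\rho(U)$ is the spectral radius, and $U$ is any real matrix with $U^TU=\tilde A^T\tilde A+d_m^2\tilde G^T\tilde G$; 2. $Q_1=Q_2$, $R_1=R_2$, and the communication graph with adjacency matrix $[a_{ij}]$ is strongly connected. Then the deterministic stationary policy which schedules sensor 1 if $\tau_1>\tau_2$ and sensor 2 if $\tau_1\le\tau_2$, that is $$(\pi^*_1(s),\pi^*_2(s))=\begin{cases}(1,0),&\tau_1>\tau_2,\\(0,1),&\tau_1\le\tau_2,\end{cases}$$ is optimal. -/

import Mathlib

open scoped Matrix Topology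
open Filter MeasureTheory ProbabilityTheory

/-- A complex network of `N` coupled nodes with states in `ℝⁿ` and sensors with measurements
in `ℝᵐ`,
`x_{k+1,i} = A x_{k,i} + μ ∑_j a_{ij} G x_{k,j} + ω_{k,i}`, `y_{k,i} = C x_{k,i} + ν_{k,i}`,
where `Q i`, `R i` are the covariances of the noises `ω_{k,i}`, `ν_{k,i}`. Moreover `rate` is the
probability that a scheduled packet arrives and `κ` is the price of one scheduling operation. -/
structure SensorNetwork (N n m : ℕ) where
  A : Matrix (Fin n) (Fin n) ℝ
  G : Matrix (Fin n) (Fin n) ℝ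
  C : Matrix (Fin m) (Fin n) ℝ
  μ : ℝ
  Q : Fin N → Matrix (Fin n) (Fin n) ℝ
  R : Fin N → Matrix (Fin m) (Fin m) ℝ
  /-- `adj i j` says that `a_{ij} = 1`, i.e. node `i` receives information from node `j`. -/
  adj : Fin N → Fin N → Bool
  rate : ℝ
  κ : ℝ
  μ_nonneg : 0 ≤ μ
  Q_posDef : ∀ i, (Q i).PosDef
  R_posDef : ∀ i, (R i).PosDef
  adj_irrefl : ∀ i, adj i i = false
  rate_nonneg : 0 ≤ rate
  rate_le_one : rate ≤ 1
  κ_pos : 0 < κ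

/-- The states `x_k` of the system `x_{k+1} = F (A + w_k A₀) x_k` along the noise `w`. -/
def noisyState {n : ℕ} (F A A₀ : Matrix (Fin n) (Fin n) ℝ) (x₀ : Fin n → ℝ) (w : ℕ → ℝ) :
    ℕ → Fin n → ℝ
  | 0 => x₀
  | k + 1 => (F * (A + w k • A₀)) *ᵥ noisyState F A A₀ x₀ w k

/-- `(A, A₀, C)` is detectable: for some gain `K` the system
`x_{k+1} = (I - K C) (A + A₀ w_k) x_k`, with independent standard Gaussian `w_k`, is
asymptotically mean-square stable, i.e. `E ‖x_k‖² → 0` for every initial state. -/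
def MeanSquareDetectable {n m : ℕ} (A A₀ : Matrix (Fin n) (Fin n) ℝ)
    (C : Matrix (Fin m) (Fin n) ℝ) : Prop :=
  ∃ K : Matrix (Fin n) (Fin m) ℝ, ∀ x₀ : Fin n → ℝ,
    Tendsto (fun k : ℕ => ∫⁻ w : ℕ → ℝ,
        ENNReal.ofReal (noisyState (1 - K * C) A A₀ x₀ w k ⬝ᵥ noisyState (1 - K * C) A A₀ x₀ w k)
        ∂(Measure.infinitePi fun _ : ℕ => gaussianReal 0 1))
      atTop (𝓝 0)

/-- The spectral radius of a real square matrix (largest modulus of a complex eigenvalue). -/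
noncomputable def realSpectralRadius {n : ℕ} (U : Matrix (Fin n) (Fin n) ℝ) : ℝ :=
  (spectralRadius ℂ (U.map (fun x : ℝ => (x : ℂ)))).toReal

/-- An MDP state `s = (τ_1, …, τ_N)`: `τ_i ≥ 1` is the time elapsed since the last reception of a
packet by node `i`. -/
abbrev AgeState (N : ℕ) : Type := Fin N → ℕ+

/-- An action `a = (α_1, …, α_N) ∈ {0, 1}^N`: sensor `i` transmits if and only if `α_i = 1`. -/
abbrev SchedAction (N : ℕ) : Type := Fin N → Bool

/-- A (history-dependent) scheduling policy: the action at step `k` is a function of the past pairs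
`(s_0, a_0), …, (s_{k-1}, a_{k-1})` and of the current state `s_k`. -/
abbrev SchedPolicy (N : ℕ) : Type :=
  ℕ → List (AgeState N × SchedAction N) → AgeState N → SchedAction N

/-- The deterministic stationary policy given by a map from states to actions. -/
def SchedPolicy.stationary {N : ℕ} (f : AgeState N → SchedAction N) : SchedPolicy N :=
  fun _ _ s => f s

/-- Exactly `M` sensors are scheduled at every step. -/
def SchedPolicy.Feasible {N : ℕ} (M : ℕ) (π : SchedPolicy N) : Prop :=
  ∀ k h s, ∑ i, (π k h s i).toNat = M

namespace SensorNetwork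

variable {N n m : ℕ} (W : SensorNetwork N n m)

/-- `Ã = √(1 + μ) A`. -/
noncomputable def tildeA : Matrix (Fin n) (Fin n) ℝ := √(1 + W.μ) • W.A

/-- `G̃ = √(μ + μ²) G`. -/
noncomputable def tildeG : Matrix (Fin n) (Fin n) ℝ := √(W.μ + W.μ ^ 2) • W.G

/-- The set of neighbours of node `i`. -/
def nbrs (i : Fin N) : Finset (Fin N) := Finset.univ.filter fun j => W.adj i j = true

/-- `d_i`, the number of neighbours of node `i`. -/
def deg (i : Fin N) : ℕ := (W.nbrs i).card

/-- `d_m = max_i d_i`. -/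
def maxDeg : ℕ := Finset.univ.sup W.deg

/-- `h_i(Y) = Ã Y_i Ãᵀ + d_i ∑_{j ∈ 𝒩_i} G̃ Y_j G̃ᵀ + Q_i`. -/
noncomputable def predict (Y : Fin N → Matrix (Fin n) (Fin n) ℝ) (i : Fin N) :
    Matrix (Fin n) (Fin n) ℝ :=
  W.tildeA * Y i * W.tildeAᵀ + (W.deg i : ℝ) • ∑ j ∈ W.nbrs i, W.tildeG * Y j * W.tildeGᵀ + W.Q i

/-- The error-covariance bounds of the distributed estimator run by the sensors, started from `0`:
the bound before the measurement is `h_i`, and the measurement update turns a bound `X` into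
`(X⁻¹ + Cᵀ R_i⁻¹ C)⁻¹`. -/
noncomputable def sensorCov : ℕ → Fin N → Matrix (Fin n) (Fin n) ℝ
  | 0 => fun _ => 0
  | k + 1 => fun i => ((W.predict (sensorCov k) i)⁻¹ + W.Cᵀ * (W.R i)⁻¹ * W.C)⁻¹

/-- The steady state `P_i` of the sensors' covariance bounds. -/
noncomputable def steadyCov (i : Fin N) : Matrix (Fin n) (Fin n) ℝ :=
  limUnder atTop fun k => W.sensorCov k i

/-- The performance matrices `Y_{l,i}` of the nodes, `l = 0, 1, …`, as they stand at step `k`, when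
node `i` last received a packet at step `k - τ_i ≥ 0`. A received packet contains all estimates
of its sensor since the previous reception, hence `Y_{l,i} = P_i` for all `l ≤ k - τ_i`; afterwards
the node can only predict. -/
noncomputable def nodeCov (τ : AgeState N) (k : ℕ) : ℕ → Fin N → Matrix (Fin n) (Fin n) ℝ
  | 0 => W.steadyCov
  | l + 1 => fun i =>
      if l + 1 + (τ i : ℕ) ≤ k then W.steadyCov i else W.predict (nodeCov τ k l) i

/-- The performance index `P_{k,i} = h_i(Y_{k-1})` of node `i` in state `τ`. It does not change if
all steps are shifted, so the current step `k` is taken to be `max_i τ_i`, which places the oldest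
of the last receptions at step `0`. -/
noncomputable def perfIndex (τ : AgeState N) (i : Fin N) : Matrix (Fin n) (Fin n) ℝ :=
  let k : ℕ := Finset.univ.sup fun j => (τ j : ℕ)
  W.predict (W.nodeCov τ k (k - 1)) i

/-- The one-stage cost `c(s, a) = ∑_i (Tr P_{k,i} + κ α_i)`. -/
noncomputable def stageCost (s : AgeState N) (a : SchedAction N) : ℝ :=
  ∑ i, ((W.perfIndex s i).trace + W.κ * ((a i).toNat : ℝ))

/-- The transition probability `Pr(τ' | τ, α)` of one node. -/
noncomputable def ageProb (τ : ℕ+) (α : Bool) (τ' : ℕ+) : ℝ :=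
  if τ' = 1 ∧ α = true then W.rate
  else if τ' = τ + 1 ∧ α = true then 1 - W.rate
  else if τ' = τ + 1 ∧ α = false then 1
  else 0

/-- The transition probability `𝒫(s' | s, a) = ∏_i Pr(τ'_i | τ_i, α_i)`. -/
noncomputable def transProb (s : AgeState N) (a : SchedAction N) (s' : AgeState N) : ℝ :=
  ∏ i, W.ageProb (s i) (a i) (s' i)

theorem transProb_eq_sum (s : AgeState N) (a : SchedAction N) (s' : AgeState N) :
    W.transProb s a s' = ∑ β : Fin N → Bool,
      if s' = (fun i => if a i && β i then 1 else s i + 1) then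
        ∏ i, (if β i then W.rate else 1 - W.rate) else 0 := by
  have key : ∀ i, W.ageProb (s i) (a i) (s' i) = ∑ b : Bool,
      (if s' i = (if a i && b then 1 else s i + 1) then
        (if b then W.rate else 1 - W.rate) else 0) := by
    intro i
    have h : (1 : ℕ+) ≠ s i + 1 := fun h => by
      have := congrArg PNat.val h
      have h2 := (s i).pos
      simp at this
    cases ha : a i
    · by_cases h1 : s' i = s i + 1 <;> simp [ageProb, h1]
    · by_cases h1 : s' i = 1
      · simp [ageProb, h1, h]
      · by_cases h2 : s' i = s i + 1 <;> simp [ageProb, h1, h2, h.symm]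
  unfold transProb
  simp_rw [key]
  rw [Finset.prod_univ_sum]
  simp only [Fintype.piFinset_univ]
  refine Finset.sum_congr rfl fun β _ => ?_
  by_cases h : s' = (fun i => if a i && β i then 1 else s i + 1)
  · rw [if_pos h]
    refine Finset.prod_congr rfl fun i _ => ?_
    rw [if_pos (congrFun h i)]
  · rw [if_neg h]
    obtain ⟨i, hi⟩ := Function.ne_iff.mp h
    exact Finset.prod_eq_zero (Finset.mem_univ i) (if_neg hi)

theorem hasSum_transProb (s : AgeState N) (a : SchedAction N) :
    HasSum (fun s' => ENNReal.ofReal (W.transProb s a s')) 1 := by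
  have hr0 := W.rate_nonneg
  have hr1 : 0 ≤ 1 - W.rate := sub_nonneg.mpr W.rate_le_one
  have hw : ∀ β : Fin N → Bool, 0 ≤ ∏ i, (if β i then W.rate else 1 - W.rate) := fun β =>
    Finset.prod_nonneg fun i _ => by split_ifs <;> assumption
  have h1 : HasSum (fun s' => W.transProb s a s') 1 := by
    have h2 : HasSum (fun s' => ∑ β : Fin N → Bool,
        if s' = (fun i => if a i && β i then 1 else s i + 1) then
          ∏ i, (if β i then W.rate else 1 - W.rate) else 0)
        (∑ β : Fin N → Bool, ∏ i, (if β i then W.rate else 1 - W.rate)) :=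
      hasSum_sum fun β _ => hasSum_ite_eq _ _
    have h3 : ∑ β : Fin N → Bool, ∏ i, (if β i then W.rate else 1 - W.rate) = 1 := by
      have := Finset.prod_univ_sum (fun _ : Fin N => (Finset.univ : Finset Bool))
        (fun _ b => if b then W.rate else 1 - W.rate)
      simp only [Fintype.piFinset_univ] at this
      rw [← this]
      simp
    rw [h3] at h2
    simpa only [transProb_eq_sum] using h2
  have h0 : ∀ s', 0 ≤ W.transProb s a s' := fun s' => by
    rw [transProb_eq_sum]
    exact Finset.sum_nonneg fun β _ => by split_ifs <;> first | exact hw β | exact le_rfl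
  have := ENNReal.ofReal_tsum_of_nonneg h0 h1.summable
  rw [h1.tsum_eq, ENNReal.ofReal_one] at this
  exact this ▸ ENNReal.summable.hasSum

/-- The transition kernel as a probability distribution of the next state. -/
noncomputable def transition (s : AgeState N) (a : SchedAction N) : PMF (AgeState N) :=
  ⟨fun s' => ENNReal.ofReal (W.transProb s a s'), W.hasSum_transProb s a⟩

/-- The law, under the policy `π` and the initial state `s₀`, of the history up to step `k`: the
list of the past pairs `(s_0, a_0), …, (s_{k-1}, a_{k-1})` together with the state `s_k`. -/
noncomputable def historyLaw (π : SchedPolicy N) (s₀ : AgeState N) :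
    ℕ → PMF (List (AgeState N × SchedAction N) × AgeState N)
  | 0 => PMF.pure ([], s₀)
  | k + 1 => (historyLaw π s₀ k).bind fun x =>
      (W.transition x.2 (π k x.1 x.2)).map fun s' => (x.1 ++ [(x.2, π k x.1 x.2)], s')

/-- The expected cost `E[c(s_k, a_k)]` at step `k`; the sum has only finitely many nonzero terms. -/
noncomputable def expectedStageCost (π : SchedPolicy N) (s₀ : AgeState N) (k : ℕ) : ℝ :=
  ∑' x, (W.historyLaw π s₀ k x).toReal * W.stageCost x.2 (π k x.1 x.2)

/-- The expected average cost `J(s₀, π) = limsup_{T → ∞} (1/T) E[∑_{k=1}^T c(s_k, a_k)]`,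
possibly infinite. -/
noncomputable def avgCost (s₀ : AgeState N) (π : SchedPolicy N) : EReal :=
  limsup (fun T : ℕ =>
    (((1 / (T : ℝ)) * ∑ k ∈ Finset.Icc 1 T, W.expectedStageCost π s₀ k : ℝ) : EReal)) atTop

/-- `π` is optimal: it schedules exactly `M` sensors at every step and, from every initial state,
its expected average cost is minimal among all such policies. -/
def IsOptimal (M : ℕ) (π : SchedPolicy N) : Prop :=
  π.Feasible M ∧
    ∀ s₀ : AgeState N, ∀ π' : SchedPolicy N, π'.Feasible M → W.avgCost s₀ π ≤ W.avgCost s₀ π'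

/-- The sensors' estimator is stable: `(Ã, d_m G̃, C)` is detectable. -/
def EstimatorDetectable : Prop :=
  MeanSquareDetectable W.tildeA ((W.maxDeg : ℝ) • W.tildeG) W.C

/-- `(1 - λ) ρ(U)^{2r} < 1` with `r = ⌈N / M⌉`, where `UᵀU = ÃᵀÃ + d_m² G̃ᵀG̃`. -/
def FeasibilityCondition (M : ℕ) (U : Matrix (Fin n) (Fin n) ℝ) : Prop :=
  Uᵀ * U = W.tildeAᵀ * W.tildeA + ((W.maxDeg : ℝ) ^ 2) • (W.tildeGᵀ * W.tildeG) ∧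
    (1 - W.rate) * realSpectralRadius U ^ (2 * ⌈(N : ℝ) / (M : ℝ)⌉₊) < 1

/-- The noise covariances are the same for all nodes, and the communication graph is strongly
connected. -/
def IdenticalConnected : Prop :=
  (∀ i j, W.Q i = W.Q j) ∧ (∀ i j, W.R i = W.R j) ∧
    ∀ i j, Relation.ReflTransGen (fun p q => W.adj p q = true) i j

end SensorNetwork

/-! Every feasible policy pays the same price `κ` per step, so only the total trace matters. As a
function of the two ages it is monotone and, by the symmetry of the two nodes, invariant under
exchanging them. For every function `g` with these two properties, scheduling the older sensor
minimizes the one-step mean: without an arrival all actions lead to the same state, and after an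
arrival the surviving age is smallest when the older one was reset. The resulting one-step mean is
again monotone and swap-invariant, so induction on the step (`stateMean_maxAgeFirst_le`) makes the
policy minimize the expected cost at every single step, hence also on average.

Monotonicity (`nodeCov_mono`) rests on `P_i ≤ h_i(P)`, which needs the limit `P` to exist. The
sensor iterates are monotone, and detectability bounds them: the stabilizing gain `K` is a
suboptimal filter whose covariance is controlled by a Lyapunov inequality (`exists_lyapunov`,
`exists_sensorCov_le`). -/

section MatrixOrderLemmas

/-! ### The Loewner order on real matrices. -/

open scoped MatrixOrder

variable {ι ι' : Type*} [Fintype ι] [Fintype ι']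

theorem Matrix.mul_mul_transpose_nonneg {X : Matrix ι ι ℝ} (h : 0 ≤ X) (M : Matrix ι' ι ℝ) :
    0 ≤ M * X * Mᵀ := by
  rw [Matrix.nonneg_iff_posSemidef] at h ⊢
  have := h.mul_mul_conjTranspose_same M
  rwa [Matrix.conjTranspose_eq_transpose_of_trivial] at this

theorem Matrix.mul_mul_transpose_mono {X Y : Matrix ι ι ℝ} (h : X ≤ Y) (M : Matrix ι' ι ℝ) :
    M * X * Mᵀ ≤ M * Y * Mᵀ := by
  have := Matrix.mul_mul_transpose_nonneg (sub_nonneg.2 h) M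
  rw [Matrix.mul_sub, Matrix.sub_mul] at this
  exact sub_nonneg.1 this

omit [Fintype ι] in
theorem Matrix.smul_nonneg' {X : Matrix ι ι ℝ} (h : 0 ≤ X) {c : ℝ} (hc : 0 ≤ c) : 0 ≤ c • X := by
  rw [Matrix.nonneg_iff_posSemidef] at h ⊢
  exact h.smul hc

omit [Fintype ι] in
theorem Matrix.smul_mono_left {X : Matrix ι ι ℝ} (h : 0 ≤ X) {c d : ℝ} (hc : c ≤ d) :
    c • X ≤ d • X := by
  have := Matrix.smul_nonneg' h (sub_nonneg.2 hc)
  rw [sub_smul] at this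
  exact sub_nonneg.1 this

omit [Fintype ι] in
theorem Matrix.smul_mono_right {X Y : Matrix ι ι ℝ} (h : X ≤ Y) {c : ℝ} (hc : 0 ≤ c) :
    c • X ≤ c • Y := by
  have := Matrix.smul_nonneg' (sub_nonneg.2 h) hc
  rw [smul_sub] at this
  exact sub_nonneg.1 this

theorem Matrix.trace_mono' {X Y : Matrix ι ι ℝ} (h : X ≤ Y) : X.trace ≤ Y.trace := by
  have := (Matrix.le_iff.1 h).trace_nonneg
  rw [Matrix.trace_sub] at this
  linarith

theorem Matrix.dotProduct_mulVec_mono {X Y : Matrix ι ι ℝ} (h : X ≤ Y) (v : ι → ℝ) :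
    v ⬝ᵥ X *ᵥ v ≤ v ⬝ᵥ Y *ᵥ v := by
  have := (Matrix.le_iff.1 h).dotProduct_mulVec_nonneg v
  rw [Matrix.sub_mulVec, dotProduct_sub, star_trivial] at this
  linarith

omit [Fintype ι] in
theorem Matrix.nonneg_transpose_eq {X : Matrix ι ι ℝ} (h : 0 ≤ X) : Xᵀ = X := by
  have := (Matrix.nonneg_iff_posSemidef.1 h).isHermitian
  rwa [Matrix.IsHermitian, Matrix.conjTranspose_eq_transpose_of_trivial] at this

theorem Matrix.nonneg_of_transpose_eq {X : Matrix ι ι ℝ} (h : Xᵀ = X)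
    (h0 : ∀ v : ι → ℝ, 0 ≤ v ⬝ᵥ X *ᵥ v) : 0 ≤ X := by
  rw [Matrix.nonneg_iff_posSemidef]
  refine .of_dotProduct_mulVec_nonneg ?_ fun v => by simpa using h0 v
  rwa [Matrix.IsHermitian, Matrix.conjTranspose_eq_transpose_of_trivial]

/-- The set of positive semidefinite matrices is closed. -/
theorem Matrix.isClosed_nonneg : IsClosed {X : Matrix ι ι ℝ | 0 ≤ X} := by
  have : {X : Matrix ι ι ℝ | 0 ≤ X} =
      {X | Xᵀ = X} ∩ ⋂ v : ι → ℝ, {X | 0 ≤ v ⬝ᵥ X *ᵥ v} := by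
    ext X
    simp only [Set.mem_ofPred_eq, Set.mem_inter_iff, Set.mem_iInter]
    refine ⟨fun h => ⟨Matrix.nonneg_transpose_eq h, fun v => ?_⟩,
      fun h => Matrix.nonneg_of_transpose_eq h.1 h.2⟩
    simpa using (Matrix.nonneg_iff_posSemidef.1 h).dotProduct_mulVec_nonneg v
  rw [this]
  refine (isClosed_eq (by fun_prop) (by fun_prop)).inter (isClosed_iInter fun v => ?_)
  exact isClosed_le (by fun_prop) (by fun_prop)

theorem Matrix.nonneg_of_tendsto {X : ℕ → Matrix ι ι ℝ} {L : Matrix ι ι ℝ}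
    (h : Tendsto X atTop (𝓝 L)) (h0 : ∀ k, 0 ≤ X k) : 0 ≤ L :=
  Matrix.isClosed_nonneg.mem_of_tendsto h (Eventually.of_forall h0)

theorem Matrix.le_of_tendsto_of_le {X Y : ℕ → Matrix ι ι ℝ} {L M : Matrix ι ι ℝ}
    (hX : Tendsto X atTop (𝓝 L)) (hY : Tendsto Y atTop (𝓝 M)) (h : ∀ k, X k ≤ Y k) : L ≤ M :=
  sub_nonneg.1 (Matrix.nonneg_of_tendsto (hY.sub hX) fun k => sub_nonneg.2 (h k))

/-- A positive semidefinite matrix is dominated by its trace. -/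
theorem Matrix.le_trace_smul_one [DecidableEq ι] {X : Matrix ι ι ℝ} (h : 0 ≤ X) :
    X ≤ X.trace • (1 : Matrix ι ι ℝ) := by
  have hX := Matrix.nonneg_transpose_eq h
  -- With `X = BᵀB` the claim becomes the Cauchy–Schwarz inequality for each row of `B`, summed over
  -- the rows.
  obtain ⟨B, hB⟩ := CStarAlgebra.nonneg_iff_eq_star_mul_self.mp h
  rw [Matrix.star_eq_conjTranspose, Matrix.conjTranspose_eq_transpose_of_trivial] at hB
  rw [← sub_nonneg]
  refine Matrix.nonneg_of_transpose_eq (by simp [hX]) fun v => ?_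
  have h1 : v ⬝ᵥ X *ᵥ v = ∑ i, (∑ j, B i j * v j) ^ 2 := by
    rw [hB, ← Matrix.mulVec_mulVec, Matrix.dotProduct_mulVec, Matrix.vecMul_transpose]
    simp [dotProduct, Matrix.mulVec, sq]
  have h2 : X.trace = ∑ i, ∑ j, B i j ^ 2 := by
    rw [hB, Finset.sum_comm]
    simp [Matrix.trace, Matrix.mul_apply, sq]
  rw [Matrix.sub_mulVec, dotProduct_sub, Matrix.smul_mulVec, Matrix.one_mulVec,
    dotProduct_smul, h1, h2, sub_nonneg, smul_eq_mul, Finset.sum_mul]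
  refine Finset.sum_le_sum fun i _ => ?_
  refine (Finset.sum_mul_sq_le_sq_mul_sq _ _ _).trans_eq ?_
  simp [dotProduct, sq]

/-- A sequence of symmetric matrices whose quadratic forms are monotone and bounded converges. -/
theorem Matrix.exists_tendsto_of_monotone_of_le [DecidableEq ι] {X : ℕ → Matrix ι ι ℝ}
    {B : Matrix ι ι ℝ} (h0 : ∀ k, 0 ≤ X k) (hmono : ∀ k, X k ≤ X (k + 1)) (hB : ∀ k, X k ≤ B) :
    ∃ L, Tendsto X atTop (𝓝 L) := by
  have hq (v : ι → ℝ) : ∃ l, Tendsto (fun k => v ⬝ᵥ X k *ᵥ v) atTop (𝓝 l) := by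
    refine ⟨_, tendsto_atTop_ciSup (monotone_nat_of_le_succ fun k =>
      Matrix.dotProduct_mulVec_mono (hmono k) v) ⟨v ⬝ᵥ B *ᵥ v, ?_⟩⟩
    rintro _ ⟨k, rfl⟩
    exact Matrix.dotProduct_mulVec_mono (hB k) v
  choose l hl using hq
  -- Polarization: symmetry of `X k` lets the limits of the quadratic forms determine each entry.
  refine ⟨Matrix.of fun i j => (1 / 4) * (l (Pi.single i 1 + Pi.single j 1) -
    l (Pi.single i 1 - Pi.single j 1)), ?_⟩
  refine tendsto_pi_nhds.2 fun i => tendsto_pi_nhds.2 fun j => ?_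
  refine (((hl _).sub (hl _)).const_mul (1 / 4)).congr fun k => ?_
  have hs : X k j i = X k i j := congrFun (congrFun (Matrix.nonneg_transpose_eq (h0 k)) i) j
  simp only [Matrix.mulVec_add, Matrix.mulVec_sub, dotProduct_add, dotProduct_sub,
    add_dotProduct, sub_dotProduct, Matrix.mulVec_single_one, single_one_dotProduct,
    Matrix.col_apply, hs]
  ring

end MatrixOrderLemmas

/-! ### The Kalman measurement update as a minimum over gains. -/

section Riccati

open scoped MatrixOrder

variable {n m : ℕ}

/-- The measurement update `(X⁻¹ + Cᵀ R⁻¹ C)⁻¹` of a covariance matrix `X`. -/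
noncomputable def measUpdate (C : Matrix (Fin m) (Fin n) ℝ) (R : Matrix (Fin m) (Fin m) ℝ)
    (X : Matrix (Fin n) (Fin n) ℝ) : Matrix (Fin n) (Fin n) ℝ :=
  (X⁻¹ + Cᵀ * R⁻¹ * C)⁻¹

variable {C : Matrix (Fin m) (Fin n) ℝ} {R : Matrix (Fin m) (Fin m) ℝ}
  {X Y : Matrix (Fin n) (Fin n) ℝ}

theorem posDef_information (hR : R.PosDef) (hX : X.PosDef) :
    (X⁻¹ + Cᵀ * R⁻¹ * C).PosDef := by
  refine hX.inv.add_posSemidef ?_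
  have := hR.inv.posSemidef.conjTranspose_mul_mul_same C
  rwa [Matrix.conjTranspose_eq_transpose_of_trivial] at this

theorem measUpdate_nonneg (hR : R.PosDef) (hX : X.PosDef) : 0 ≤ measUpdate C R X :=
  (posDef_information hR hX).inv.posSemidef.nonneg

/-- The covariance of the linear estimator with gain `K`, completed to a square. -/
theorem joseph_sub_measUpdate (hR : R.PosDef) (hX : X.PosDef) (K : Matrix (Fin n) (Fin m) ℝ) :
    (1 - K * C) * X * (1 - K * C)ᵀ + K * R * Kᵀ - measUpdate C R X =
      ((1 - K * C) - measUpdate C R X * X⁻¹) * X * ((1 - K * C) - measUpdate C R X * X⁻¹)ᵀ +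
      (K - measUpdate C R X * Cᵀ * R⁻¹) * R * (K - measUpdate C R X * Cᵀ * R⁻¹)ᵀ := by
  have hJ := posDef_information (C := C) hR hX
  set Z := measUpdate C R X with hZ
  have hZt : Zᵀ = Z := Matrix.nonneg_transpose_eq (measUpdate_nonneg hR hX)
  have hXt : X⁻¹ᵀ = X⁻¹ := Matrix.nonneg_transpose_eq hX.inv.posSemidef.nonneg
  have hRt : R⁻¹ᵀ = R⁻¹ := Matrix.nonneg_transpose_eq hR.inv.posSemidef.nonneg
  have hX1 : X⁻¹ * X = 1 := Matrix.nonsing_inv_mul _ ((Matrix.isUnit_iff_isUnit_det _).1 hX.isUnit)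
  have hX2 : X * X⁻¹ = 1 := Matrix.mul_nonsing_inv _ ((Matrix.isUnit_iff_isUnit_det _).1 hX.isUnit)
  have hR1 : R⁻¹ * R = 1 := Matrix.nonsing_inv_mul _ ((Matrix.isUnit_iff_isUnit_det _).1 hR.isUnit)
  have hR2 : R * R⁻¹ = 1 := Matrix.mul_nonsing_inv _ ((Matrix.isUnit_iff_isUnit_det _).1 hR.isUnit)
  -- Apart from its symmetry, the only property of `Z` that is needed; through `e5` it collapses the
  -- two terms quadratic in `Z`.
  have hZJ : Z * (X⁻¹ + Cᵀ * R⁻¹ * C) * Z = Z := by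
    rw [hZ, measUpdate, Matrix.nonsing_inv_mul _ ((Matrix.isUnit_iff_isUnit_det _).1 hJ.isUnit),
      Matrix.one_mul]
  set E := 1 - K * C with hE
  have e1 : (E - Z * X⁻¹) * X * (E - Z * X⁻¹)ᵀ =
      E * X * Eᵀ - E * Z - Z * Eᵀ + Z * X⁻¹ * Z := by
    rw [Matrix.transpose_sub, Matrix.transpose_mul, hXt, hZt]
    simp only [Matrix.sub_mul, Matrix.mul_sub]
    rw [show Z * X⁻¹ * X = Z by rw [Matrix.mul_assoc, hX1, Matrix.mul_one],
      show E * X * (X⁻¹ * Z) = E * Z by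
        rw [Matrix.mul_assoc, ← Matrix.mul_assoc X, hX2, Matrix.one_mul], ← Matrix.mul_assoc]
    abel
  have e2 : (K - Z * Cᵀ * R⁻¹) * R * (K - Z * Cᵀ * R⁻¹)ᵀ =
      K * R * Kᵀ - K * C * Z - Z * (K * C)ᵀ + Z * (Cᵀ * R⁻¹ * C) * Z := by
    rw [Matrix.transpose_sub, Matrix.transpose_mul, Matrix.transpose_mul, hRt, hZt,
      Matrix.transpose_transpose, Matrix.transpose_mul]
    simp only [Matrix.sub_mul, Matrix.mul_sub]
    rw [show Z * Cᵀ * R⁻¹ * R = Z * Cᵀ by rw [Matrix.mul_assoc, hR1, Matrix.mul_one],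
      show K * R * (R⁻¹ * (C * Z)) = K * C * Z by
        rw [Matrix.mul_assoc, ← Matrix.mul_assoc R, hR2, Matrix.one_mul, Matrix.mul_assoc]]
    simp only [Matrix.mul_assoc]
    abel
  have e3 : E * Z = Z - K * C * Z := by rw [hE, Matrix.sub_mul, Matrix.one_mul]
  have e4 : Z * Eᵀ = Z - Z * (K * C)ᵀ := by
    rw [hE, Matrix.transpose_sub, Matrix.transpose_one, Matrix.mul_sub, Matrix.mul_one]
  have e5 : Z * X⁻¹ * Z = Z - Z * (Cᵀ * R⁻¹ * C) * Z := by
    rw [eq_sub_iff_add_eq, ← Matrix.add_mul, ← Matrix.mul_add, hZJ]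
  rw [e1, e2, e3, e4, e5]
  abel

/-- The difference is a sum of two congruences of positive matrices. The bound holds for every gain
and is monotone in `X`, so each later estimate of `measUpdate` amounts to a choice of `K`. -/
theorem measUpdate_le_joseph (hR : R.PosDef) (hX : X.PosDef) (K : Matrix (Fin n) (Fin m) ℝ) :
    measUpdate C R X ≤ (1 - K * C) * X * (1 - K * C)ᵀ + K * R * Kᵀ := by
  rw [← sub_nonneg, joseph_sub_measUpdate hR hX]
  exact add_nonneg (Matrix.mul_mul_transpose_nonneg hX.posSemidef.nonneg _)
    (Matrix.mul_mul_transpose_nonneg hR.posSemidef.nonneg _)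

theorem measUpdate_le (hR : R.PosDef) (hX : X.PosDef) : measUpdate C R X ≤ X := by
  simpa using measUpdate_le_joseph (C := C) hR hX 0

/-- The Kalman gain attains the measurement update. -/
theorem joseph_kalmanGain (hR : R.PosDef) (hX : X.PosDef) :
    (1 - measUpdate C R X * Cᵀ * R⁻¹ * C) * X * (1 - measUpdate C R X * Cᵀ * R⁻¹ * C)ᵀ +
      measUpdate C R X * Cᵀ * R⁻¹ * R * (measUpdate C R X * Cᵀ * R⁻¹)ᵀ = measUpdate C R X := by
  have h := joseph_sub_measUpdate (C := C) hR hX (measUpdate C R X * Cᵀ * R⁻¹)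
  have hE : 1 - measUpdate C R X * Cᵀ * R⁻¹ * C - measUpdate C R X * X⁻¹ = 0 := by
    have : measUpdate C R X * (X⁻¹ + Cᵀ * R⁻¹ * C) = 1 :=
      Matrix.nonsing_inv_mul _ ((Matrix.isUnit_iff_isUnit_det _).1 (posDef_information hR hX).isUnit)
    rw [← this, Matrix.mul_add]
    simp only [Matrix.mul_assoc]
    abel
  rw [hE] at h
  simp only [sub_self, Matrix.zero_mul, add_zero] at h
  exact sub_eq_zero.1 h

/-- The optimal gain for `Y` is admissible, though suboptimal, for `X`. -/
theorem measUpdate_mono (hR : R.PosDef) (hX : X.PosDef) (hY : Y.PosDef) (h : X ≤ Y) :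
    measUpdate C R X ≤ measUpdate C R Y := by
  rw [← joseph_kalmanGain hR hY]
  exact (measUpdate_le_joseph hR hX _).trans
    (add_le_add (Matrix.mul_mul_transpose_mono h _) le_rfl)

end Riccati

/-! ### Mean-square stability and Lyapunov inequalities. -/

section SecondMoment

open scoped MatrixOrder

variable {n : ℕ}

/-- The evolution of the second-moment matrix of `x_{k+1} = F (A + w_k A₀) x_k`. -/
def secondMomentMap (F A A₀ : Matrix (Fin n) (Fin n) ℝ) :
    Matrix (Fin n) (Fin n) ℝ →ₗ[ℝ] Matrix (Fin n) (Fin n) ℝ where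
  toFun Z := (F * A) * Z * (F * A)ᵀ + (F * A₀) * Z * (F * A₀)ᵀ
  map_add' X Y := by
    simp only [Matrix.mul_add, Matrix.add_mul]
    abel
  map_smul' c X := by simp

theorem secondMomentMap_apply (F A A₀ Z : Matrix (Fin n) (Fin n) ℝ) :
    secondMomentMap F A A₀ Z = (F * A) * Z * (F * A)ᵀ + (F * A₀) * Z * (F * A₀)ᵀ := rfl

theorem secondMomentMap_nonneg (F A A₀ : Matrix (Fin n) (Fin n) ℝ)
    {Z : Matrix (Fin n) (Fin n) ℝ} (h : 0 ≤ Z) : 0 ≤ secondMomentMap F A A₀ Z :=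
  add_nonneg (Matrix.mul_mul_transpose_nonneg h _) (Matrix.mul_mul_transpose_nonneg h _)

theorem secondMomentMap_pow_nonneg (F A A₀ : Matrix (Fin n) (Fin n) ℝ)
    {Z : Matrix (Fin n) (Fin n) ℝ} (h : 0 ≤ Z) (k : ℕ) : 0 ≤ (secondMomentMap F A A₀ ^ k) Z := by
  induction k with
  | zero => simpa using h
  | succ k ih =>
    rw [pow_succ']
    exact secondMomentMap_nonneg F A A₀ ih

theorem measurable_noisyState (F A A₀ : Matrix (Fin n) (Fin n) ℝ) (x₀ : Fin n → ℝ) (k : ℕ)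
    (a : Fin n) : Measurable fun w : ℕ → ℝ => noisyState F A A₀ x₀ w k a := by
  induction k generalizing a with
  | zero => exact measurable_const
  | succ k ih =>
    simp only [noisyState, Matrix.mulVec, dotProduct, Matrix.mul_apply, Matrix.add_apply,
      Matrix.smul_apply, smul_eq_mul]
    fun_prop (disch := assumption)

theorem noisyState_congr (F A A₀ : Matrix (Fin n) (Fin n) ℝ) (x₀ : Fin n → ℝ) {w w' : ℕ → ℝ}
    {k : ℕ} (h : ∀ j < k, w j = w' j) : noisyState F A A₀ x₀ w k = noisyState F A A₀ x₀ w' k := by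
  induction k with
  | zero => rfl
  | succ k ih =>
    simp only [noisyState]
    rw [ih fun j hj => h j (hj.trans k.lt_succ_self), h k k.lt_succ_self]

theorem noisyState_succ_apply (F A A₀ : Matrix (Fin n) (Fin n) ℝ) (x₀ : Fin n → ℝ) (w : ℕ → ℝ)
    (k : ℕ) (a : Fin n) : noisyState F A A₀ x₀ w (k + 1) a =
      ∑ c, (F * A) a c * noisyState F A A₀ x₀ w k c +
        w k * ∑ c, (F * A₀) a c * noisyState F A A₀ x₀ w k c := by
  simp only [noisyState, Matrix.mul_add, Matrix.mul_smul, Matrix.mulVec, dotProduct,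
    Matrix.add_apply, Matrix.smul_apply, smul_eq_mul, add_mul, Finset.sum_add_distrib,
    Finset.mul_sum, mul_assoc]

/-- The law of a sequence of independent standard Gaussian random variables. -/
noncomputable abbrev gaussianNoise : Measure (ℕ → ℝ) :=
  Measure.infinitePi fun _ : ℕ => gaussianReal 0 1

/-- The current noise is independent of the current state. -/
theorem indepFun_noisyState (F A A₀ : Matrix (Fin n) (Fin n) ℝ) (x₀ : Fin n → ℝ) (k : ℕ)
    {f : (Fin n → ℝ) → ℝ} (hf : Measurable f) {g : ℝ → ℝ} (hg : Measurable g) :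
    IndepFun (fun w : ℕ → ℝ => f (noisyState F A A₀ x₀ w k)) (fun w : ℕ → ℝ => g (w k))
      gaussianNoise := by
  have hi : iIndepFun (fun (i : ℕ) (w : ℕ → ℝ) => w i) gaussianNoise :=
    iIndepFun_infinitePi (P := fun _ : ℕ => gaussianReal 0 1) (X := fun _ x => x)
      (fun _ => measurable_id)
  have h := hi.indepFun_finset (Finset.range k) {k} (by simp) fun i => measurable_pi_apply i
  -- Padding the first `k` noises by zeros is harmless, since the state at step `k` depends on
  -- nothing else.
  let ext : (Finset.range k → ℝ) → ℕ → ℝ :=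
    fun v j => if hj : j ∈ Finset.range k then v ⟨j, hj⟩ else 0
  have hext : Measurable ext := by
    refine measurable_pi_lambda _ fun j => ?_
    by_cases hj : j ∈ Finset.range k
    · simp only [ext, dif_pos hj]
      exact measurable_pi_apply _
    · simp only [ext, dif_neg hj]
      exact measurable_const
  have hz : Measurable fun w : ℕ → ℝ => noisyState F A A₀ x₀ w k :=
    measurable_pi_lambda _ fun a => measurable_noisyState F A A₀ x₀ k a
  have h2 := h.comp (φ := fun v => f (noisyState F A A₀ x₀ (ext v) k))
    (ψ := fun v : ({k} : Finset ℕ) → ℝ => g (v ⟨k, Finset.mem_singleton_self k⟩))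
    (hf.comp (hz.comp hext)) (by fun_prop)
  refine h2.congr (Eventually.of_forall fun w => ?_) (Eventually.of_forall fun w => rfl)
  refine congrArg f (noisyState_congr F A A₀ x₀ fun j hj => ?_)
  simp [ext, hj]

theorem integrable_gaussianNoise_sq (k : ℕ) :
    Integrable (fun w : ℕ → ℝ => w k ^ 2) gaussianNoise := by
  have h : Integrable (fun x : ℝ => x ^ 2) (gaussianReal 0 1) :=
    (memLp_id_gaussianReal (μ := 0) (v := 1) 2).integrable_sq
  exact (measurePreserving_eval_infinitePi (fun _ : ℕ => gaussianReal 0 1) k).integrable_comp_of_integrable h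

theorem integrable_gaussianNoise (k : ℕ) :
    Integrable (fun w : ℕ → ℝ => w k) gaussianNoise := by
  have h : Integrable (fun x : ℝ => x) (gaussianReal 0 1) :=
    memLp_one_iff_integrable.1 (memLp_id_gaussianReal (μ := 0) (v := 1) 1)
  exact (measurePreserving_eval_infinitePi (fun _ : ℕ => gaussianReal 0 1) k).integrable_comp_of_integrable h

theorem integral_gaussianNoise (k : ℕ) : ∫ w : ℕ → ℝ, w k ∂gaussianNoise = 0 := by
  have h := integral_map (μ := gaussianNoise) (measurable_pi_apply k).aemeasurable
    (f := fun x : ℝ => x) (by fun_prop)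
  rw [← h, Measure.infinitePi_map_eval]
  exact integral_id_gaussianReal

theorem integral_gaussianNoise_sq (k : ℕ) : ∫ w : ℕ → ℝ, w k ^ 2 ∂gaussianNoise = 1 := by
  have h := integral_map (μ := gaussianNoise) (measurable_pi_apply k).aemeasurable
    (f := fun x : ℝ => x ^ 2) (by fun_prop)
  rw [← h, Measure.infinitePi_map_eval]
  have hv := variance_eq_integral (μ := gaussianReal 0 1) (X := fun x : ℝ => x) (by fun_prop)
  rw [variance_fun_id_gaussianReal, integral_id_gaussianReal] at hv
  simpa using hv.symm

/-- `f` is integrable with mean `c` under the noise law. -/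
def HasNoiseMean (f : (ℕ → ℝ) → ℝ) (c : ℝ) : Prop :=
  Integrable f gaussianNoise ∧ ∫ w, f w ∂gaussianNoise = c

theorem HasNoiseMean.add {f g : (ℕ → ℝ) → ℝ} {c d : ℝ} (hf : HasNoiseMean f c)
    (hg : HasNoiseMean g d) : HasNoiseMean (fun w => f w + g w) (c + d) :=
  ⟨hf.1.add hg.1, by rw [integral_add hf.1 hg.1, hf.2, hg.2]⟩

theorem HasNoiseMean.const_mul {f : (ℕ → ℝ) → ℝ} {c : ℝ} (hf : HasNoiseMean f c) (r : ℝ) :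
    HasNoiseMean (fun w => r * f w) (r * c) :=
  ⟨hf.1.const_mul r, by rw [integral_const_mul, hf.2]⟩

theorem HasNoiseMean.sum {ι : Type*} {s : Finset ι} {f : ι → (ℕ → ℝ) → ℝ} {c : ι → ℝ}
    (hf : ∀ i, HasNoiseMean (f i) (c i)) :
    HasNoiseMean (fun w => ∑ i ∈ s, f i w) (∑ i ∈ s, c i) :=
  ⟨integrable_finsetSum _ fun i _ => (hf i).1, by
    rw [integral_finsetSum _ fun i _ => (hf i).1]
    exact Finset.sum_congr rfl fun i _ => (hf i).2⟩

theorem HasNoiseMean.mul_indep {f g : (ℕ → ℝ) → ℝ} {c d : ℝ} (hf : HasNoiseMean f c)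
    (hg : HasNoiseMean g d) (h : IndepFun f g gaussianNoise) :
    HasNoiseMean (fun w => f w * g w) (c * d) :=
  ⟨h.integrable_mul hf.1 hg.1, by
    rw [h.integral_fun_mul_eq_mul_integral hf.1.1 hg.1.1, hf.2, hg.2]⟩

/-- The second moments of the states evolve by `secondMomentMap`. -/
theorem hasNoiseMean_noisyState (F A A₀ : Matrix (Fin n) (Fin n) ℝ) (x₀ : Fin n → ℝ) (k : ℕ)
    (a b : Fin n) :
    HasNoiseMean (fun w => noisyState F A A₀ x₀ w k a * noisyState F A A₀ x₀ w k b)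
      ((secondMomentMap F A A₀ ^ k) (Matrix.vecMulVec x₀ x₀) a b) := by
  induction k generalizing a b with
  | zero =>
    exact ⟨integrable_const (x₀ a * x₀ b), by simp [noisyState, Matrix.vecMulVec_apply]⟩
  | succ k ih =>
    set Z := (secondMomentMap F A A₀ ^ k) (Matrix.vecMulVec x₀ x₀) with hZ
    have hform (p q : Fin n → ℝ) : HasNoiseMean
        (fun w => (∑ c, p c * noisyState F A A₀ x₀ w k c) *
          (∑ d, q d * noisyState F A A₀ x₀ w k d)) (∑ c, ∑ d, p c * q d * Z c d) := by
      have := HasNoiseMean.sum (s := Finset.univ) fun c => HasNoiseMean.sum (s := Finset.univ)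
        fun d => (ih c d).const_mul (p c * q d)
      convert this using 2 with w
      rw [Finset.sum_mul_sum]
      refine Finset.sum_congr rfl fun c _ => Finset.sum_congr rfl fun d _ => ?_
      ring
    have hind (p q : Fin n → ℝ) {g : ℝ → ℝ} (hg : Measurable g) : IndepFun
        (fun w => (∑ c, p c * noisyState F A A₀ x₀ w k c) *
          (∑ d, q d * noisyState F A A₀ x₀ w k d)) (fun w => g (w k)) gaussianNoise :=
      indepFun_noisyState F A A₀ x₀ k
        (f := fun x => (∑ c, p c * x c) * (∑ d, q d * x d)) (by fun_prop) hg
    have h1 : HasNoiseMean (fun w => w k) 0 :=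
      ⟨integrable_gaussianNoise k, integral_gaussianNoise k⟩
    have h2 : HasNoiseMean (fun w => w k ^ 2) 1 :=
      ⟨integrable_gaussianNoise_sq k, integral_gaussianNoise_sq k⟩
    -- The product of two new coordinates is a quadratic polynomial in `w k` with coefficients
    -- independent of `w k`: the linear terms have mean zero and the square contributes the factor
    -- 1.
    have h := (((hform ((F * A) a) ((F * A) b)).add
      ((hform ((F * A) a) ((F * A₀) b)).mul_indep h1 (hind _ _ measurable_id))).add
      ((hform ((F * A₀) a) ((F * A) b)).mul_indep h1 (hind _ _ measurable_id))).add
      ((hform ((F * A₀) a) ((F * A₀) b)).mul_indep h2 (hind _ _ (measurable_id.pow_const 2)))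
    convert h using 1
    · ext w
      rw [noisyState_succ_apply, noisyState_succ_apply]
      ring
    · have hent (M : Matrix (Fin n) (Fin n) ℝ) :
          (M * Z * Mᵀ) a b = ∑ c, ∑ d, M a c * M b d * Z c d := by
        simp only [Matrix.mul_apply, Matrix.transpose_apply, Finset.sum_mul]
        rw [Finset.sum_comm]
        refine Finset.sum_congr rfl fun c _ => Finset.sum_congr rfl fun d _ => ?_
        ring
      rw [pow_succ', Module.End.mul_apply, secondMomentMap_apply, Matrix.add_apply, hent, hent]
      simp

/-- The mean square of the state is the trace of its second-moment matrix. -/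
theorem lintegral_noisyState (F A A₀ : Matrix (Fin n) (Fin n) ℝ) (x₀ : Fin n → ℝ) (k : ℕ) :
    ∫⁻ w, ENNReal.ofReal (noisyState F A A₀ x₀ w k ⬝ᵥ noisyState F A A₀ x₀ w k) ∂gaussianNoise =
      ENNReal.ofReal ((secondMomentMap F A A₀ ^ k) (Matrix.vecMulVec x₀ x₀)).trace := by
  have h : HasNoiseMean (fun w => noisyState F A A₀ x₀ w k ⬝ᵥ noisyState F A A₀ x₀ w k)
      ((secondMomentMap F A A₀ ^ k) (Matrix.vecMulVec x₀ x₀)).trace :=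
    HasNoiseMean.sum fun a => hasNoiseMean_noisyState F A A₀ x₀ k a a
  rw [← h.2, ofReal_integral_eq_lintegral_ofReal h.1]
  exact Eventually.of_forall fun w => Finset.sum_nonneg fun i _ => mul_self_nonneg _

/-- Mean-square stability gives a solution of every Lyapunov inequality. -/
theorem exists_lyapunov {F A A₀ : Matrix (Fin n) (Fin n) ℝ}
    (h : ∀ x₀ : Fin n → ℝ, Tendsto (fun k : ℕ => ∫⁻ w : ℕ → ℝ,
        ENNReal.ofReal (noisyState F A A₀ x₀ w k ⬝ᵥ noisyState F A A₀ x₀ w k) ∂gaussianNoise)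
      atTop (𝓝 0)) {c : ℝ} (hc : 0 ≤ c) :
    ∃ B : Matrix (Fin n) (Fin n) ℝ, 0 ≤ B ∧
      secondMomentMap F A A₀ B + c • (1 : Matrix (Fin n) (Fin n) ℝ) ≤ B := by
  set Φ := secondMomentMap F A A₀ with hΦ
  have h1 : (0 : Matrix (Fin n) (Fin n) ℝ) ≤ 1 := Matrix.PosSemidef.one.nonneg
  have hone : ∑ i : Fin n, Matrix.vecMulVec (Pi.single i (1 : ℝ)) (Pi.single i (1 : ℝ)) =
      (1 : Matrix (Fin n) (Fin n) ℝ) := by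
    ext a b
    simp [Matrix.sum_apply, Matrix.vecMulVec_apply, Pi.single_apply, Matrix.one_apply]
  have htr : Tendsto (fun k => ((Φ ^ k) 1).trace) atTop (𝓝 0) := by
    have h2 (i : Fin n) : Tendsto (fun k => ((Φ ^ k)
        (Matrix.vecMulVec (Pi.single i (1 : ℝ)) (Pi.single i (1 : ℝ)))).trace) atTop (𝓝 0) := by
      have h3 := h (Pi.single i 1)
      simp_rw [lintegral_noisyState] at h3
      have h4 := (ENNReal.tendsto_toReal ENNReal.zero_ne_top).comp h3
      refine h4.congr fun k => ENNReal.toReal_ofReal ?_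
      refine (Matrix.nonneg_iff_posSemidef.1
        (secondMomentMap_pow_nonneg F A A₀ ?_ k)).trace_nonneg
      have := Matrix.posSemidef_vecMulVec_self_star (Pi.single i (1 : ℝ) : Fin n → ℝ)
      rw [star_trivial] at this
      exact this.nonneg
    have h5 := tendsto_finsetSum Finset.univ fun i _ => h2 i
    simp only [Finset.sum_const_zero] at h5
    refine h5.congr fun k => ?_
    rw [← Matrix.trace_sum, ← map_sum, hone]
  -- The trace dominates the matrix, so `Φ ^ p` maps `1` below half of itself.
  obtain ⟨p, hp⟩ := (htr.eventually_lt_const (show (0 : ℝ) < 1 / 2 by norm_num)).exists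
  have hpow (k : ℕ) := secondMomentMap_pow_nonneg F A A₀ h1 k
  have hhalf : (Φ ^ p) 1 ≤ (1 / 2 : ℝ) • (1 : Matrix (Fin n) (Fin n) ℝ) :=
    (Matrix.le_trace_smul_one (hpow p)).trans (Matrix.smul_mono_left h1 hp.le)
  -- A truncated Neumann series: `B - Φ B` telescopes to `2c (1 - Φ^p 1) ≥ c • 1`.
  refine ⟨(2 * c) • ∑ j ∈ Finset.range p, (Φ ^ j) 1,
    Matrix.smul_nonneg' (Finset.sum_nonneg fun j _ => hpow j) (by positivity), ?_⟩
  have hshift : ∑ j ∈ Finset.range p, (Φ ^ (j + 1)) 1 =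
      ∑ j ∈ Finset.range p, (Φ ^ j) 1 + (Φ ^ p) 1 - 1 := by
    rw [← Finset.sum_range_succ, Finset.sum_range_succ' _ p]
    simp
  rw [map_smul, map_sum, show ∑ j ∈ Finset.range p, Φ ((Φ ^ j) 1) =
    ∑ j ∈ Finset.range p, (Φ ^ (j + 1)) 1 from Finset.sum_congr rfl fun j _ => by
      rw [pow_succ', Module.End.mul_apply], hshift]
  have h6 := Matrix.smul_mono_right hhalf (show 0 ≤ 2 * c by positivity)
  rw [← sub_nonneg] at h6 ⊢
  convert h6 using 1
  module

end SecondMoment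

/-! ### Convergence of the sensors' covariance bounds. -/

section SensorCov

open scoped MatrixOrder

namespace SensorNetwork

variable {N n m : ℕ} (W : SensorNetwork N n m)

theorem predict_mono {Y Y' : Fin N → Matrix (Fin n) (Fin n) ℝ} (h : ∀ i, Y i ≤ Y' i) (i : Fin N) :
    W.predict Y i ≤ W.predict Y' i := by
  refine add_le_add (add_le_add (Matrix.mul_mul_transpose_mono (h i) _)
    (Matrix.smul_mono_right (Finset.sum_le_sum fun j _ => ?_) (Nat.cast_nonneg _))) le_rfl
  exact Matrix.mul_mul_transpose_mono (h j) _

theorem predict_posDef {Y : Fin N → Matrix (Fin n) (Fin n) ℝ} (h : ∀ i, 0 ≤ Y i) (i : Fin N) :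
    (W.predict Y i).PosDef := by
  refine (W.Q_posDef i).posSemidef_add ?_
  rw [← Matrix.nonneg_iff_posSemidef]
  refine add_nonneg (Matrix.mul_mul_transpose_nonneg (h i) _) (Matrix.smul_nonneg'
    (Finset.sum_nonneg fun j _ => Matrix.mul_mul_transpose_nonneg (h j) _) (Nat.cast_nonneg _))

theorem continuous_predict (i : Fin N) : Continuous fun Y => W.predict Y i := by
  unfold predict
  fun_prop

theorem deg_le_maxDeg (i : Fin N) : W.deg i ≤ W.maxDeg :=
  Finset.le_sup (f := W.deg) (Finset.mem_univ i)

/-- At equal arguments, the coupling terms are dominated by those of a node of maximal degree. -/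
theorem predict_const_le {B : Matrix (Fin n) (Fin n) ℝ} (hB : 0 ≤ B) (i : Fin N) :
    W.predict (fun _ => B) i ≤ W.tildeA * B * W.tildeAᵀ +
      ((W.maxDeg : ℝ) • W.tildeG) * B * ((W.maxDeg : ℝ) • W.tildeG)ᵀ + W.Q i := by
  refine add_le_add (add_le_add le_rfl ?_) le_rfl
  have h0 := Matrix.mul_mul_transpose_nonneg hB W.tildeG
  have hd : (W.deg i : ℝ) ≤ W.maxDeg := by exact_mod_cast W.deg_le_maxDeg i
  have h := Matrix.smul_mono_left h0 (mul_self_le_mul_self (Nat.cast_nonneg _) hd)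
  convert h using 1
  · rw [Finset.sum_const, ← deg, ← Nat.cast_smul_eq_nsmul ℝ, smul_smul]
  · simp [smul_smul]

theorem sensorCov_succ (k : ℕ) (i : Fin N) :
    W.sensorCov (k + 1) i = measUpdate W.C (W.R i) (W.predict (W.sensorCov k) i) := rfl

theorem sensorCov_nonneg (k : ℕ) (i : Fin N) : 0 ≤ W.sensorCov k i := by
  induction k generalizing i with
  | zero => exact le_rfl
  | succ k ih => exact measUpdate_nonneg (W.R_posDef i) (W.predict_posDef ih i)

theorem sensorCov_le_succ (k : ℕ) (i : Fin N) : W.sensorCov k i ≤ W.sensorCov (k + 1) i := by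
  induction k generalizing i with
  | zero => exact W.sensorCov_nonneg 1 i
  | succ k ih =>
    exact measUpdate_mono (W.R_posDef i) (W.predict_posDef (W.sensorCov_nonneg k) i)
      (W.predict_posDef (W.sensorCov_nonneg (k + 1)) i) (W.predict_mono ih i)

/-- One matrix `B` serves all nodes: with equal arguments the coupling is at most `d_m² G̃ B G̃ᵀ`,
exactly the multiplicative-noise term of the detectability condition. Using the stabilizing gain at
every step, the Lyapunov inequality then keeps the iterates below `B`. -/
theorem exists_sensorCov_le (h : W.EstimatorDetectable) :
    ∃ B : Matrix (Fin n) (Fin n) ℝ, ∀ k i, W.sensorCov k i ≤ B := by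
  obtain ⟨K, hK⟩ := h
  set F := 1 - K * W.C with hF
  set M : Fin N → Matrix (Fin n) (Fin n) ℝ := fun i => F * W.Q i * Fᵀ + K * W.R i * Kᵀ with hM
  have hM0 (i : Fin N) : 0 ≤ M i :=
    add_nonneg (Matrix.mul_mul_transpose_nonneg (W.Q_posDef i).posSemidef.nonneg _)
      (Matrix.mul_mul_transpose_nonneg (W.R_posDef i).posSemidef.nonneg _)
  have htr (i : Fin N) : 0 ≤ (M i).trace := 
    (Matrix.nonneg_iff_posSemidef.1 (hM0 i)).trace_nonneg
  -- The sum of the traces is a single constant dominating every `M i`.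
  obtain ⟨B, hB0, hB⟩ := exists_lyapunov hK (Finset.sum_nonneg fun i (_ : i ∈ Finset.univ) => htr i)
  refine ⟨B, fun k => ?_⟩
  induction k with
  | zero => exact fun _ => hB0
  | succ k ih =>
    intro i
    have hMi : M i ≤ (∑ i, (M i).trace) • (1 : Matrix (Fin n) (Fin n) ℝ) :=
      (Matrix.le_trace_smul_one (hM0 i)).trans (Matrix.smul_mono_left Matrix.PosSemidef.one.nonneg
        (Finset.single_le_sum (fun j _ => htr j) (Finset.mem_univ i)))
    have h1 := measUpdate_le_joseph (C := W.C) (W.R_posDef i)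
      (W.predict_posDef (W.sensorCov_nonneg k) i) K
    have h2 := Matrix.mul_mul_transpose_mono
      ((W.predict_mono ih i).trans (W.predict_const_le hB0 i)) F
    refine h1.trans ((add_le_add h2 le_rfl).trans ?_)
    refine le_trans (le_of_eq ?_) ((add_le_add le_rfl hMi).trans hB)
    simp only [secondMomentMap_apply, hM, Matrix.transpose_mul, Matrix.mul_add, Matrix.add_mul,
      Matrix.mul_assoc]
    abel

/-- Without convergence the `limUnder` in `steadyCov` would be an arbitrary value. -/
theorem tendsto_sensorCov (h : W.EstimatorDetectable) (i : Fin N) :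
    Tendsto (fun k => W.sensorCov k i) atTop (𝓝 (W.steadyCov i)) := by
  obtain ⟨B, hB⟩ := W.exists_sensorCov_le h
  exact tendsto_nhds_limUnder (Matrix.exists_tendsto_of_monotone_of_le
    (fun k => W.sensorCov_nonneg k i) (fun k => W.sensorCov_le_succ k i) fun k => hB k i)

theorem steadyCov_nonneg (h : W.EstimatorDetectable) (i : Fin N) : 0 ≤ W.steadyCov i :=
  Matrix.nonneg_of_tendsto (W.tendsto_sensorCov h i) fun k => W.sensorCov_nonneg k i

/-- A measurement only decreases the covariance; this passes to the limit. -/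
theorem steadyCov_le_predict (h : W.EstimatorDetectable) (i : Fin N) :
    W.steadyCov i ≤ W.predict W.steadyCov i := by
  have h1 : Tendsto (fun k => W.predict (W.sensorCov k) i) atTop
      (𝓝 (W.predict W.steadyCov i)) :=
    ((W.continuous_predict i).tendsto _).comp
      (tendsto_pi_nhds.2 fun j => W.tendsto_sensorCov h j)
  exact Matrix.le_of_tendsto_of_le ((tendsto_add_atTop_iff_nat 1).2 (W.tendsto_sensorCov h i)) h1
    fun k => measUpdate_le (W.R_posDef i) (W.predict_posDef (W.sensorCov_nonneg k) i)

end SensorNetwork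

end SensorCov

/-! ### Monotonicity of the cost in the ages. -/

section NodeCov

open scoped MatrixOrder

namespace SensorNetwork

variable {N n m : ℕ} (W : SensorNetwork N n m)

theorem steadyCov_le_nodeCov (h : W.EstimatorDetectable) (τ : AgeState N) (k l : ℕ) (i : Fin N) :
    W.steadyCov i ≤ W.nodeCov τ k l i := by
  induction l generalizing i with
  | zero => exact le_rfl
  | succ l ih =>
    simp only [nodeCov]
    split_ifs
    · exact le_rfl
    · exact (W.steadyCov_le_predict h i).trans (W.predict_mono ih i)

/-- Older receptions increase the performance matrices, also if the step is shifted. -/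
theorem nodeCov_mono (h : W.EstimatorDetectable) {τ τ' : AgeState N} (hτ : τ ≤ τ') (k l d : ℕ)
    (i : Fin N) : W.nodeCov τ k l i ≤ W.nodeCov τ' (k + d) (l + d) i := by
  induction l generalizing i with
  | zero => exact W.steadyCov_le_nodeCov h _ _ _ _
  | succ l ih =>
    -- Where the fresher node still holds `P_i`, this is the least possible value. Otherwise the
    -- older node is predicting too, even after the shift by `d`.
    by_cases h1 : l + 1 + (τ i : ℕ) ≤ k
    · have : W.nodeCov τ k (l + 1) i = W.steadyCov i := if_pos h1
      rw [this]
      exact W.steadyCov_le_nodeCov h _ _ _ _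
    · have hi : (τ i : ℕ) ≤ τ' i := hτ i
      have h2 : ¬ l + d + 1 + (τ' i : ℕ) ≤ k + d := by omega
      have e1 : W.nodeCov τ k (l + 1) i = W.predict (W.nodeCov τ k l) i := if_neg h1
      have e2 : W.nodeCov τ' (k + d) (l + 1 + d) i =
          W.predict (W.nodeCov τ' (k + d) (l + d)) i := by
        rw [show l + 1 + d = l + d + 1 by omega]
        exact if_neg h2
      rw [e1, e2]
      exact W.predict_mono ih i

/-- The total trace of the performance indices, i.e. the stage cost without the price of
scheduling. -/
noncomputable def traceCost (s : AgeState N) : ℝ := ∑ i, (W.perfIndex s i).trace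

theorem perfIndex_mono [NeZero N] (h : W.EstimatorDetectable) {τ τ' : AgeState N} (hτ : τ ≤ τ')
    (i : Fin N) : W.perfIndex τ i ≤ W.perfIndex τ' i := by
  simp only [perfIndex]
  set k := Finset.univ.sup fun j => (τ j : ℕ) with hk
  set k' := Finset.univ.sup fun j => (τ' j : ℕ) with hk'
  have hkk : k ≤ k' := Finset.sup_mono_fun fun j _ => hτ j
  -- The two indices use different clocks `k ≤ k'`. As ages are positive, `k - 1` is not truncated,
  -- and the shift `k' - k` aligns the final steps.
  have hk1 : 1 ≤ k := (τ 0).pos.trans_le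
    (Finset.le_sup (f := fun j => (τ j : ℕ)) (Finset.mem_univ (0 : Fin N)))
  refine W.predict_mono (fun j => ?_) i
  have := W.nodeCov_mono h hτ k (k - 1) (k' - k) j
  rwa [show k + (k' - k) = k' by omega, show k - 1 + (k' - k) = k' - 1 by omega] at this

theorem traceCost_mono [NeZero N] (h : W.EstimatorDetectable) : Monotone W.traceCost :=
  fun _ _ hτ => Finset.sum_le_sum fun i _ => Matrix.trace_mono' (W.perfIndex_mono h hτ i)

theorem traceCost_nonneg (h : W.EstimatorDetectable) (s : AgeState N) : 0 ≤ W.traceCost s :=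
  Finset.sum_nonneg fun i _ => (W.predict_posDef (fun j =>
    (W.steadyCov_nonneg h j).trans (W.steadyCov_le_nodeCov h _ _ _ j)) i).posSemidef.trace_nonneg

theorem stageCost_eq {M : ℕ} (s : AgeState N) {a : SchedAction N} (ha : ∑ i, (a i).toNat = M) :
    W.stageCost s a = W.traceCost s + W.κ * M := by
  rw [stageCost, Finset.sum_add_distrib, ← Finset.mul_sum, traceCost, ← ha]
  push_cast
  rfl

end SensorNetwork

end NodeCov

/-! ### Symmetry under exchanging the two nodes. -/

section TwoNodes

namespace SensorNetwork

variable {n m : ℕ} (W : SensorNetwork 2 n m)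

/-- Without self-loops, a path to the other node must begin with the direct edge. -/
theorem nbrs_eq (h : W.IdenticalConnected) (i : Fin 2) : W.nbrs i = {i.rev} := by
  have hrev : ∀ j i : Fin 2, j ≠ i → j = i.rev := by decide
  have hadj : W.adj i i.rev = true := by
    rcases Relation.ReflTransGen.cases_head (h.2.2 i i.rev) with h1 | ⟨c, hc, -⟩
    · exact absurd h1 (by decide +revert)
    · have hne : c ≠ i := fun hci => by simp [hci, W.adj_irrefl] at hc
      rwa [← hrev c i hne]
  ext j
  simp only [nbrs, Finset.mem_filter, Finset.mem_univ, true_and, Finset.mem_singleton]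
  exact ⟨fun hj => hrev j i fun hji => by simp [hji, W.adj_irrefl] at hj, fun hj => hj ▸ hadj⟩

theorem predict_eq (h : W.IdenticalConnected) (Y : Fin 2 → Matrix (Fin n) (Fin n) ℝ) (i : Fin 2) :
    W.predict Y i =
      W.tildeA * Y i * W.tildeAᵀ + W.tildeG * Y i.rev * W.tildeGᵀ + W.Q 0 := by
  simp [predict, deg, W.nbrs_eq h, h.1 i 0]

theorem predict_comp_rev (h : W.IdenticalConnected) (Y : Fin 2 → Matrix (Fin n) (Fin n) ℝ)
    (i : Fin 2) : W.predict (fun j => Y j.rev) i = W.predict Y i.rev := by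
  simp [W.predict_eq h]

theorem sensorCov_rev (h : W.IdenticalConnected) (k : ℕ) (i : Fin 2) :
    W.sensorCov k i.rev = W.sensorCov k i := by
  induction k generalizing i with
  | zero => rfl
  | succ k ih =>
    rw [sensorCov_succ, sensorCov_succ, ← W.predict_comp_rev h, funext ih, h.2.1 i.rev i]

theorem steadyCov_rev (h : W.IdenticalConnected) (i : Fin 2) :
    W.steadyCov i.rev = W.steadyCov i := by
  simp only [steadyCov, W.sensorCov_rev h]

theorem nodeCov_comp_rev (h : W.IdenticalConnected) (τ : AgeState 2) (k l : ℕ) (i : Fin 2) :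
    W.nodeCov (fun j => τ j.rev) k l i = W.nodeCov τ k l i.rev := by
  induction l generalizing i with
  | zero => exact (W.steadyCov_rev h i).symm
  | succ l ih =>
    simp only [nodeCov, W.steadyCov_rev h, funext ih, W.predict_comp_rev h]

theorem traceCost_comp_rev (h : W.IdenticalConnected) (τ : AgeState 2) :
    W.traceCost (fun j => τ j.rev) = W.traceCost τ := by
  have hs : (Finset.univ.sup fun j : Fin 2 => (τ j.rev : ℕ)) =
      Finset.univ.sup fun j : Fin 2 => (τ j : ℕ) := by
    simp [Fin.univ_succ, sup_comm]
  have hp (i : Fin 2) : W.perfIndex (fun j => τ j.rev) i = W.perfIndex τ i.rev := by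
    simp only [perfIndex, hs, funext (W.nodeCov_comp_rev h τ _ _), W.predict_comp_rev h]
  simp only [traceCost, hp]
  exact Equiv.sum_comp Fin.revPerm fun i => (W.perfIndex τ i).trace

end SensorNetwork

end TwoNodes

/-! ### Expectations along the controlled age process. -/

section AgeProcess

open scoped ENNReal

namespace SensorNetwork

variable {N n m : ℕ} (W : SensorNetwork N n m)

/-- The expectation of `g` at the next state. -/
noncomputable def nextMean (g : AgeState N → ℝ≥0∞) (s : AgeState N) (a : SchedAction N) : ℝ≥0∞ :=
  ∑' s', W.transition s a s' * g s'

/-- The expectation of `g (s_k)` under the policy `π`. -/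
noncomputable def stateMean (π : SchedPolicy N) (s₀ : AgeState N) (k : ℕ)
    (g : AgeState N → ℝ≥0∞) : ℝ≥0∞ :=
  ∑' x, W.historyLaw π s₀ k x * g x.2

theorem nextMean_eq_sum (g : AgeState N → ℝ≥0∞) (s : AgeState N) (a : SchedAction N) :
    W.nextMean g s a = ∑ β : Fin N → Bool,
      (∏ i, ENNReal.ofReal (if β i then W.rate else 1 - W.rate)) *
        g (fun i => if a i && β i then 1 else s i + 1) := by
  have hb (b : Bool) : 0 ≤ if b then W.rate else 1 - W.rate := by
    split_ifs
    exacts [W.rate_nonneg, sub_nonneg.2 W.rate_le_one]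
  have ht (s' : AgeState N) : W.transition s a s' = ∑ β : Fin N → Bool,
      if s' = (fun i => if a i && β i then 1 else s i + 1) then
        ∏ i, ENNReal.ofReal (if β i then W.rate else 1 - W.rate) else 0 := by
    change ENNReal.ofReal (W.transProb s a s') = _
    rw [transProb_eq_sum, ENNReal.ofReal_sum_of_nonneg fun β _ => by
      split_ifs
      exacts [Finset.prod_nonneg fun i _ => hb (β i), le_rfl]]
    refine Finset.sum_congr rfl fun β _ => ?_
    split_ifs
    · exact ENNReal.ofReal_prod_of_nonneg fun i _ => hb (β i)
    · exact ENNReal.ofReal_zero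
  simp only [nextMean, ht, Finset.sum_mul]
  rw [Summable.tsum_finsetSum fun _ _ => ENNReal.summable]
  refine Finset.sum_congr rfl fun β _ => ?_
  rw [tsum_eq_single (fun i => if a i && β i then 1 else s i + 1)
    fun s' hs' => by rw [if_neg hs', zero_mul], if_pos rfl]

theorem nextMean_le (g : AgeState N → ℝ≥0∞) (hg : Monotone g) (s : AgeState N)
    (a : SchedAction N) : W.nextMean g s a ≤ g (fun i => s i + 1) := by
  calc W.nextMean g s a ≤ ∑' s', W.transition s a s' * g (fun i => s i + 1) := by
        refine ENNReal.tsum_le_tsum fun s' => ?_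
        by_cases hs : W.transition s a s' = 0
        · simp [hs]
        refine mul_le_mul_right (hg fun i => ?_) _
        by_contra hlt
        refine hs ?_
        change ENNReal.ofReal (W.transProb s a s') = 0
        have : W.ageProb (s i) (a i) (s' i) = 0 := by
          have h1 : s' i ≠ 1 := fun h => hlt (h.le.trans (one_le ..))
          have h2 : s' i ≠ s i + 1 := fun h => hlt h.le
          simp [ageProb, h1, h2]
        rw [transProb, Finset.prod_eq_zero (Finset.mem_univ i) this, ENNReal.ofReal_zero]
    _ = g (fun i => s i + 1) := by
        rw [ENNReal.tsum_mul_right, PMF.tsum_coe, one_mul]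

theorem stateMean_zero (π : SchedPolicy N) (s₀ : AgeState N) (g : AgeState N → ℝ≥0∞) :
    W.stateMean π s₀ 0 g = g s₀ := by
  rw [stateMean, tsum_eq_single ([], s₀) fun x hx => ?_]
  · simp [historyLaw]
  · rw [historyLaw, PMF.pure_apply_of_ne _ _ hx, zero_mul]

theorem stateMean_succ (π : SchedPolicy N) (s₀ : AgeState N) (k : ℕ) (g : AgeState N → ℝ≥0∞) :
    W.stateMean π s₀ (k + 1) g =
      ∑' x, W.historyLaw π s₀ k x * W.nextMean g x.2 (π k x.1 x.2) := by
  simp only [stateMean, historyLaw, PMF.bind_apply]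
  simp_rw [← ENNReal.tsum_mul_right]
  rw [ENNReal.tsum_comm]
  refine tsum_congr fun x => ?_
  simp_rw [mul_assoc]
  rw [ENNReal.tsum_mul_left]
  congr 1
  simp_rw [PMF.map_apply, ← ENNReal.tsum_mul_right]
  rw [ENNReal.tsum_comm]
  refine tsum_congr fun s' => ?_
  rw [tsum_eq_single (x.1 ++ [(x.2, π k x.1 x.2)], s') fun y hy => by rw [if_neg hy, zero_mul],
    if_pos rfl]

/-- Ages grow by at most one per step, so a monotone `g` stays below its value at the initial ages
increased by `k`. Finiteness matters because `toReal` sends `∞` to `0`. -/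
theorem stateMean_lt_top (π : SchedPolicy N) (s₀ : AgeState N) (k : ℕ) {g : AgeState N → ℝ≥0∞}
    (hg : Monotone g) (hfin : ∀ s, g s < ∞) : W.stateMean π s₀ k g < ∞ := by
  induction k generalizing g with
  | zero => exact (W.stateMean_zero π s₀ g).trans_lt (hfin _)
  | succ k ih =>
    rw [stateMean_succ]
    refine lt_of_le_of_lt (ENNReal.tsum_le_tsum fun x =>
      mul_le_mul_right (W.nextMean_le g hg _ _) _) (ih (g := fun s => g fun i => s i + 1) ?_ ?_)
    · exact fun s s' h => hg fun i => add_le_add_left (h i) 1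
    · exact fun s => hfin _

theorem expectedStageCost_eq {M : ℕ} (h : W.EstimatorDetectable) {π : SchedPolicy N}
    (hπ : π.Feasible M) (s₀ : AgeState N) (k : ℕ) : W.expectedStageCost π s₀ k =
      (W.stateMean π s₀ k fun s => ENNReal.ofReal (W.traceCost s + W.κ * M)).toReal := by
  rw [stateMean, ENNReal.tsum_toReal_eq fun x =>
    ENNReal.mul_ne_top (PMF.apply_ne_top _ _) ENNReal.ofReal_ne_top]
  refine tsum_congr fun x => ?_
  rw [W.stageCost_eq _ (hπ k x.1 x.2), ENNReal.toReal_mul, ENNReal.toReal_ofReal]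
  exact add_nonneg (W.traceCost_nonneg h _) (mul_nonneg W.κ_pos.le (Nat.cast_nonneg _))

end SensorNetwork

end AgeProcess

/-! ### Optimality of scheduling the older sensor. -/

section MaxAgeFirst

open scoped ENNReal

/-- The action that schedules the sensor with the older packet. -/
def maxAgeFirst (s : AgeState 2) : SchedAction 2 :=
  if s 0 > s 1 then ![true, false] else ![false, true]

theorem feasible_maxAgeFirst : (SchedPolicy.stationary maxAgeFirst).Feasible 1 := by
  intro k h s
  by_cases hs : s 0 > s 1 <;> simp [SchedPolicy.stationary, maxAgeFirst, hs]

theorem SchedPolicy.Feasible.eq_or_eq {π : SchedPolicy 2} (hπ : π.Feasible 1) (k : ℕ)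
    (h : List (AgeState 2 × SchedAction 2)) (s : AgeState 2) :
    π k h s = ![true, false] ∨ π k h s = ![false, true] := by
  have key : ∀ a : SchedAction 2, ∑ i, (a i).toNat = 1 →
      a = ![true, false] ∨ a = ![false, true] := by decide
  exact key _ (hπ k h s)

/-- Invariance under exchanging the two nodes. -/
def SwapInvariant (g : AgeState 2 → ℝ≥0∞) : Prop := ∀ s, g (fun i => s i.rev) = g s

theorem SwapInvariant.apply_pair {g : AgeState 2 → ℝ≥0∞} (hg : SwapInvariant g) (a b : ℕ+) :
    g ![a, b] = g ![b, a] := by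
  rw [← hg ![b, a]]
  congr 1
  ext i
  fin_cases i <;> rfl

namespace SensorNetwork

variable {n m : ℕ} (W : SensorNetwork 2 n m)

theorem ofReal_rate_add : ENNReal.ofReal W.rate + ENNReal.ofReal (1 - W.rate) = 1 := by
  rw [← ENNReal.ofReal_add W.rate_nonneg (sub_nonneg.2 W.rate_le_one)]
  simp

/-- The mean over the two independent packet arrivals. -/
theorem nextMean_eq_four (g : AgeState 2 → ℝ≥0∞) (s : AgeState 2) (a : SchedAction 2) :
    W.nextMean g s a =
      ENNReal.ofReal W.rate * ENNReal.ofReal W.rate *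
        g ![if a 0 then 1 else s 0 + 1, if a 1 then 1 else s 1 + 1] +
      ENNReal.ofReal W.rate * ENNReal.ofReal (1 - W.rate) *
        g ![if a 0 then 1 else s 0 + 1, s 1 + 1] +
      (ENNReal.ofReal (1 - W.rate) * ENNReal.ofReal W.rate *
        g ![s 0 + 1, if a 1 then 1 else s 1 + 1] +
      ENNReal.ofReal (1 - W.rate) * ENNReal.ofReal (1 - W.rate) * g ![s 0 + 1, s 1 + 1]) := by
  have hst (β : Fin 2 → Bool) : (fun i => if a i && β i then 1 else s i + 1) =
      ![if a 0 && β 0 then 1 else s 0 + 1, if a 1 && β 1 then 1 else s 1 + 1] := by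
    ext i
    fin_cases i <;> rfl
  rw [nextMean_eq_sum, ← (finTwoArrowEquiv Bool).symm.sum_comp, Fintype.sum_prod_type]
  simp only [hst]
  simp [finTwoArrowEquiv]

theorem nextMean_first (g : AgeState 2 → ℝ≥0∞) (s : AgeState 2) :
    W.nextMean g s ![true, false] = ENNReal.ofReal W.rate * g ![1, s 1 + 1] +
      ENNReal.ofReal (1 - W.rate) * g ![s 0 + 1, s 1 + 1] := by
  rw [nextMean_eq_four]
  simp only [Matrix.cons_val_zero, Matrix.cons_val_one, if_true, Bool.false_eq_true, if_false]
  rw [← add_mul, ← add_mul, ← mul_add, ← mul_add, W.ofReal_rate_add, mul_one, mul_one]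

theorem nextMean_second (g : AgeState 2 → ℝ≥0∞) (s : AgeState 2) :
    W.nextMean g s ![false, true] = ENNReal.ofReal W.rate * g ![s 0 + 1, 1] +
      ENNReal.ofReal (1 - W.rate) * g ![s 0 + 1, s 1 + 1] := by
  rw [nextMean_eq_four]
  simp only [Matrix.cons_val_zero, Matrix.cons_val_one, if_true, Bool.false_eq_true, if_false]
  rw [add_add_add_comm, ← add_mul, ← add_mul, ← add_mul, ← add_mul, W.ofReal_rate_add, one_mul,
    one_mul]

/-- Swap invariance merges the two cases into one expression in which only the smaller age survives
an arrival; the tie-breaking rule leaves no trace. -/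
theorem nextMean_maxAgeFirst {g : AgeState 2 → ℝ≥0∞} (hg : SwapInvariant g) (s : AgeState 2) :
    W.nextMean g s (maxAgeFirst s) = ENNReal.ofReal W.rate * g ![min (s 0) (s 1) + 1, 1] +
      ENNReal.ofReal (1 - W.rate) * g ![s 0 + 1, s 1 + 1] := by
  rw [maxAgeFirst]
  split_ifs with h
  · rw [nextMean_first, hg.apply_pair, min_eq_right h.le]
  · rw [nextMean_second, min_eq_left (not_lt.1 h)]

theorem pair_mono {a a' b b' : ℕ+} (ha : a ≤ a') (hb : b ≤ b') :
    (![a, b] : AgeState 2) ≤ ![a', b'] := by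
  intro i
  fin_cases i
  exacts [ha, hb]

/-- Scheduling the older sensor minimizes the mean of every monotone swap-invariant function. -/
theorem nextMean_maxAgeFirst_le {g : AgeState 2 → ℝ≥0∞} (hg : SwapInvariant g) (hm : Monotone g)
    (s : AgeState 2) {a : SchedAction 2} (ha : a = ![true, false] ∨ a = ![false, true]) :
    W.nextMean g s (maxAgeFirst s) ≤ W.nextMean g s a := by
  rw [W.nextMean_maxAgeFirst hg]
  rcases ha with rfl | rfl
  · rw [nextMean_first, hg.apply_pair 1]
    gcongr
    exact hm (pair_mono (add_le_add_left (min_le_right _ _) 1) le_rfl)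
  · rw [nextMean_second]
    gcongr
    exact hm (pair_mono (add_le_add_left (min_le_left _ _) 1) le_rfl)

theorem nextMean_maxAgeFirst_mono {g : AgeState 2 → ℝ≥0∞} (hg : SwapInvariant g)
    (hm : Monotone g) : Monotone fun s => W.nextMean g s (maxAgeFirst s) := by
  intro s s' h
  simp only [W.nextMean_maxAgeFirst hg]
  gcongr
  · exact hm (pair_mono (add_le_add_left (min_le_min (h 0) (h 1)) 1) le_rfl)
  · exact hm (pair_mono (add_le_add_left (h 0) 1) (add_le_add_left (h 1) 1))

theorem nextMean_maxAgeFirst_swap {g : AgeState 2 → ℝ≥0∞} (hg : SwapInvariant g) :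
    SwapInvariant fun s => W.nextMean g s (maxAgeFirst s) := by
  intro s
  simp only [W.nextMean_maxAgeFirst hg]
  rw [min_comm, hg.apply_pair (s (Fin.rev 0) + 1)]
  rfl

/-- At every step, `maxAgeFirst` minimizes the mean of every monotone swap-invariant function. -/
theorem stateMean_maxAgeFirst_le {π : SchedPolicy 2} (hπ : π.Feasible 1) (s₀ : AgeState 2) (k : ℕ)
    {g : AgeState 2 → ℝ≥0∞} (hg : SwapInvariant g) (hm : Monotone g) :
    W.stateMean (SchedPolicy.stationary maxAgeFirst) s₀ k g ≤ W.stateMean π s₀ k g := by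
  induction k generalizing g with
  | zero => rw [stateMean_zero, stateMean_zero]
  | succ k ih =>
    rw [stateMean_succ, stateMean_succ]
    -- The induction hypothesis is applied to the one-step mean of `g` under `maxAgeFirst`, which
    -- replaces the law of the first `k` steps; the last action is then compared history by history.
    refine (ih (W.nextMean_maxAgeFirst_swap hg) (W.nextMean_maxAgeFirst_mono hg hm)).trans ?_
    exact ENNReal.tsum_le_tsum fun x =>
      mul_le_mul_right (W.nextMean_maxAgeFirst_le hg hm x.2 (hπ.eq_or_eq k x.1 x.2)) _

theorem expectedStageCost_maxAgeFirst_le (hdet : W.EstimatorDetectable)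
    (h : W.IdenticalConnected) {π : SchedPolicy 2} (hπ : π.Feasible 1) (s₀ : AgeState 2) (k : ℕ) :
    W.expectedStageCost (SchedPolicy.stationary maxAgeFirst) s₀ k ≤
      W.expectedStageCost π s₀ k := by
  rw [W.expectedStageCost_eq hdet hπ, W.expectedStageCost_eq hdet feasible_maxAgeFirst]
  have hm : Monotone fun s => ENNReal.ofReal (W.traceCost s + W.κ * (1 : ℕ)) := fun s s' hs =>
    ENNReal.ofReal_le_ofReal (add_le_add (W.traceCost_mono hdet hs) le_rfl)
  refine ENNReal.toReal_mono (W.stateMean_lt_top π s₀ k hm fun s => ENNReal.ofReal_lt_top).ne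
    (W.stateMean_maxAgeFirst_le hπ s₀ k (fun s => ?_) hm)
  simp only [W.traceCost_comp_rev h]

theorem isOptimal_maxAgeFirst (hdet : W.EstimatorDetectable) (h : W.IdenticalConnected) :
    W.IsOptimal 1 (SchedPolicy.stationary maxAgeFirst) := by
  refine ⟨feasible_maxAgeFirst, fun s₀ π hπ => limsup_le_limsup (Eventually.of_forall fun T => ?_)⟩
  refine EReal.coe_le_coe_iff.2 (mul_le_mul_of_nonneg_left ?_ (by positivity))
  exact Finset.sum_le_sum fun k _ => W.expectedStageCost_maxAgeFirst_le hdet h hπ s₀ k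

end SensorNetwork

end MaxAgeFirst

theorem corollary2 {n m : ℕ} (W : SensorNetwork 2 n m) (hdet : W.EstimatorDetectable)
    (U : Matrix (Fin n) (Fin n) ℝ) (h1 : W.FeasibilityCondition 1 U)
    (h2 : W.IdenticalConnected) :
    W.IsOptimal 1 (SchedPolicy.stationary fun s =>
      if s 0 > s 1 then ![true, false] else ![false, true]) :=
  W.isOptimal_maxAgeFirst hdet h2
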